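/- **Theorem.** HotStuff with $N=3f+1$ processes, at most $f$ of them Byzantine, refines a single instance of QTree without the value constraint: for every trace $t$ of HotStuff, the sequence $\Gamma(t)$ of QTree invocations given by the linearization points along $t$ is a trace of QTree. **QTree.** A state is a tree of nodes, each with a round (its identifier), a value, a parent and a status ADDED, GHOST or COMMITTED. Initially there is only $Root$: round $0$, COMMITTED, no value, its own parent. Two nodes *conflict* if neither is an ancestor of the other. - $add(r,v,r_p)$, for $r>0$, succeeds iff a node of round $r_p<r$ exists, no node has round $r$, and, with $c$ the COMMITTED node of highest round, the new node would descend from $c$ or $r<c.\mathrm{round}$. It then adds a node of round $r$, value $v$ and parent of round $r_p$, with status GHOST if a node of round $>r$ exists and ADDED otherwise, and turns all nodes of round $<r$ that conflict with the new node into GHOST nodes. - $commit(r)$ succeeds iff the node of round $r$ exists and is ADDED; that node becomes COMMITTED. - A successful invocation returns $OK$; any other returns $FAIL$ and changes nothing. The actions of QTree are the invocations together with their return values. **HotStuff.** A (command) node is the genesis node (round $0$) or consists of a round, a value and a parent node; a node extends itself and its ancestors. Every round $r$ has a fixed leader. A quorum is a set of at least $2f+1$ processes. Messages are signed, and may be delayed,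 lost, reordered or received repeatedly. The messages are - $\mathrm{ROUND\text{-}CHANGE}(r)$ with a node $preNode$ and, optionally, a PRECOMMIT message as certificate; it is *certified* if $preNode$ is genesis or the attached message is a valid PRECOMMIT with node $preNode$; - $\mathrm{PROPOSE}(r)$ with a node and a certificate made of ROUND-CHANGE messages; it is *valid* if these are all certified and for round $r$, a quorum of senders occurs among them, and the node has round $r$ and as its parent a $preNode$ of highest round among them; - the votes $\mathrm{JOIN}(r)$, $\mathrm{PRECOMMIT\_VOTE}(r)$, $\mathrm{COMMIT\_VOTE}(r)$, each with a node; - $\mathrm{PRECOMMIT}(r)$, $\mathrm{COMMIT}(r)$, $\mathrm{DECIDE}(r)$, each with a node and a certificate made of votes; such a message is *valid* if its certificate contains votes $\mathrm{JOIN}(r)$, $\mathrm{PRECOMMIT\_VOTE}(r)$, $\mathrm{COMMIT\_VOTE}(r)$, respectively, with the same node, from a quorum. A correct process has a current round, initially $0$, and nodes $preNode$, $votedNode$, $decidedNode$, initially genesis. Its steps are as follows. - At any time (timeout): send $\mathrm{ROUND\text{-}CHANGE}(r+1)$, where $r$ is its current round, with its $preNode$ and the PRECOMMIT message that set it (if any),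 and increment its round. - As leader of its current round $r$: send a valid $\mathrm{PROPOSE}(r)$, $\mathrm{PRECOMMIT}(r)$, $\mathrm{COMMIT}(r)$ or $\mathrm{DECIDE}(r)$ certified by messages that were sent, at most one of each per round. - On a valid message for its current round $r>0$ from the leader of $r$, whose node $n$ has round $r$: - on $\mathrm{PROPOSE}(r)$, if $n$ extends $votedNode$ or $votedNode.\mathrm{round}<n.\mathrm{parent}.\mathrm{round}$, send $\mathrm{JOIN}(r)$ with $n$; - on $\mathrm{PRECOMMIT}(r)$, set $preNode:=n$ and send $\mathrm{PRECOMMIT\_VOTE}(r)$ with $n$; - on $\mathrm{COMMIT}(r)$, set $votedNode:=n$ and send $\mathrm{COMMIT\_VOTE}(r)$ with $n$; - on $\mathrm{DECIDE}(r)$, set $decidedNode:=n$. It votes only if it has not yet voted in this or a later phase of round $r$ (the phases being ordered JOIN, PRECOMMIT\_VOTE, COMMIT\_VOTE). A Byzantine process may at any time send any message under its own name, provided that all signed messages in the attached certificate were sent before (handing a signed message on as part of a certificate presupposes its sending). **Linearization points.** Sending the first valid $\mathrm{PRECOMMIT}(r)$ in the trace, with a node of value $v$ and parent of round $r'$, is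 mapped to $add(r,v,r')\Rightarrow OK$. Sending the first valid $\mathrm{DECIDE}(r)$ is mapped to $commit(r)\Rightarrow OK$. All other actions are mapped to nothing, and $\Gamma(t)$ lists the resulting invocations in the order of the trace $t$. -/

import Mathlib

/-! ## Labeled transition systems and refinement -/

/-- A labeled transition system with a unique initial state. -/
structure LTS (Q : Type*) (A : Type*) where
  init : Q
  step : Q → A → Q → Prop

namespace LTS

/-- `L.Run t q`: some finite execution of `L` from the initial state has trace `t` and ends in `q`. -/
inductive Run {Q A : Type*} (L : LTS Q A) : List A → Q → Prop
  | nil : Run L [] L.init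
  | snoc {t : List A} {q q' : Q} {a : A} : Run L t q → L.step q a q' → Run L (t ++ [a]) q'

/-- The set of traces of `L`. -/
def traces {Q A : Type*} (L : LTS Q A) : Set (List A) := {t | ∃ q, L.Run t q}

/-- `L` is a `Γ`-refinement of `L'`: the image under `Γ` of every trace of `L` is a trace of `L'`. -/
def Refines {Q A Q' A' : Type*} (Γ : List A → List A') (L : LTS Q A) (L' : LTS Q' A') : Prop :=
  Γ '' L.traces ⊆ L'.traces

end LTS

/-! ## The QTree object, without the value constraint -/

namespace QTree

inductive Status
  | added
  | ghost
  | committed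

/-- The attributes of a node other than its round, which identifies it. The parent is given by its
round. The value `none` is the non-initialized value of the root. -/
structure Entry (α : Type*) where
  status : Status
  value : Option α
  parent : ℕ

/-- A state: the node with round `r`, if the tree has one. -/
abbrev State (α : Type*) := ℕ → Option (Entry α)

variable {α : Type*}

open Classical in
/-- Only the root: round `0`, committed, its own parent. -/
noncomputable def init (α : Type*) : State α :=
  Function.update (fun _ => none) 0 (some ⟨Status.committed, none, 0⟩)

/-- There is a path, possibly of length 0, from node `a` up to node `b` along parent pointers. -/
def Extends (s : State α) (a b : ℕ) : Prop :=
  Relation.ReflTransGen (fun x y => ∃ e, s x = some e ∧ e.parent = y) a b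

/-- Two nodes are conflicting when there is no path from one to the other. -/
def Conflicting (s : State α) (a b : ℕ) : Prop := ¬ Extends s a b ∧ ¬ Extends s b a

/-- Node `c` is committed. -/
def IsCommitted (s : State α) (c : ℕ) : Prop := ∃ e, s c = some e ∧ e.status = Status.committed

/-- Node `c` is the committed node with the highest round. -/
def MaxCommitted (s : State α) (c : ℕ) : Prop :=
  IsCommitted s c ∧ ∀ c', IsCommitted s c' → c' ≤ c

/-- The parent of the new node is in the tree and has a smaller round. -/
def Link (s : State α) (r rp : ℕ) : Prop := (∃ e, s rp = some e) ∧ rp < r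

/-- No node of the tree has round `r`. -/
def NewRound (s : State α) (r : ℕ) : Prop := s r = none

/-- The new node (round `r`, parent `rp`) extends the last committed node, or has a smaller round.
The new node, not being in the tree, extends a node of the tree iff its parent does. -/
def ExtendsTrunk (s : State α) (r rp : ℕ) : Prop :=
  ∃ c, MaxCommitted s c ∧ (Extends s rp c ∨ r < c)

def Valid (s : State α) (r rp : ℕ) : Prop := Link s r rp ∧ NewRound s r ∧ ExtendsTrunk s r rp

open Classical in
/-- The tree with a new node, of status `st`, attached; no other node is changed. -/
noncomputable def attach (s : State α) (r : ℕ) (v : α) (rp : ℕ) (st : Status) : State α :=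
  Function.update s r (some ⟨st, some v, rp⟩)

open Classical in
/-- Status of the new node: ghost if the tree has a node with a higher round, else added. -/
noncomputable def newStatus (s : State α) (r : ℕ) : Status :=
  if ∃ r', r < r' ∧ s r' ≠ none then Status.ghost else Status.added

open Classical in
/-- Every node with a round smaller than `r` that conflicts with node `r` becomes a ghost. -/
noncomputable def invalidate (s : State α) (r : ℕ) : State α := fun r' =>
  if r' < r ∧ Conflicting s r r' then (s r').map (fun e => { e with status := Status.ghost })
  else s r'

/-- Effect of a successful `add(r, v, rp)`. -/
noncomputable def addNode (s : State α) (r : ℕ) (v : α) (rp : ℕ) : State α :=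
  invalidate (attach s r v rp (newStatus s r)) r

/-- `commit(r)` is possible: the node with round `r` exists and has status added. -/
def CanCommit (s : State α) (r : ℕ) : Prop := ∃ e, s r = some e ∧ e.status = Status.added

open Classical in
/-- Effect of a successful `commit(r)`. -/
noncomputable def commitNode (s : State α) (r : ℕ) : State α :=
  Function.update s r ((s r).map (fun e => { e with status := Status.committed }))

inductive Ret
  | ok
  | fail

/-- Invocation labels `add(r, v, rp) ⇒ ret` and `commit(r) ⇒ ret`. -/
inductive Label (α : Type*)
  | add (r : ℕ) (v : α) (rp : ℕ) (ret : Ret)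
  | commit (r : ℕ) (ret : Ret)

inductive Step : State α → Label α → State α → Prop
  | add_ok {s : State α} {r rp : ℕ} {v : α} : 0 < r → Valid s r rp →
      Step s (Label.add r v rp Ret.ok) (addNode s r v rp)
  | add_fail {s : State α} {r rp : ℕ} {v : α} : 0 < r → ¬ Valid s r rp →
      Step s (Label.add r v rp Ret.fail) s
  | commit_ok {s : State α} {r : ℕ} : CanCommit s r →
      Step s (Label.commit r Ret.ok) (commitNode s r)
  | commit_fail {s : State α} {r : ℕ} : ¬ CanCommit s r →
      Step s (Label.commit r Ret.fail) s

/-- The QTree object as a labeled transition system. -/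
noncomputable def lts (α : Type*) : LTS (State α) (Label α) where
  init := init α
  step := Step

end QTree

/-! ## The HotStuff protocol -/

namespace HotStuff

/-- Nodes of the command tree. A node determines its command, its round and its whole branch. -/
inductive Node (V : Type*)
  | genesis
  | block (round : ℕ) (value : V) (parent : Node V)

namespace Node

variable {V : Type*}

def round : Node V → ℕ
  | genesis => 0
  | block r _ _ => r

def parent : Node V → Node V
  | genesis => genesis
  | block _ _ p => p

/-- `Extends n m`: `m` is on the branch from the genesis node to `n` (possibly `m = n`). -/
inductive Extends : Node V → Node V → Prop
  | refl (n : Node V) : Extends n n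
  | step {r : ℕ} {v : V} {p m : Node V} : Extends p m → Extends (block r v p) m

end Node

/-- The three kinds of votes sent to the leader of a round, in the order of the phases. -/
inductive VoteKind
  | join
  | precommitVote
  | commitVote

def VoteKind.rank : VoteKind → ℕ
  | join => 1
  | precommitVote => 2
  | commitVote => 3

/-- The three kinds of certified messages broadcast by the leader of a round after a proposal. -/
inductive LeadKind
  | precommit
  | commit
  | decide

/-- The kind of votes that certify a message of the leader. -/
def LeadKind.votes : LeadKind → VoteKind
  | precommit => VoteKind.join
  | commit => VoteKind.precommitVote
  | decide => VoteKind.commitVote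

/-- A signed `JOIN(r)`, `PRECOMMIT_VOTE(r)` or `COMMIT_VOTE(r)` message with its node. -/
structure Vote (P V : Type*) where
  sender : P
  kind : VoteKind
  round : ℕ
  node : Node V

/-- A signed `PRECOMMIT(r)`, `COMMIT(r)` or `DECIDE(r)` message with its node and a certificate,
consisting of signed votes. -/
structure LeadMsg (P V : Type*) where
  sender : P
  kind : LeadKind
  round : ℕ
  node : Node V
  cert : Finset (Vote P V)

/-- A signed `ROUND-CHANGE(r)` message with the `preNode` of its sender. As a certificate for
`preNode` it carries the `PRECOMMIT` message by which `preNode` was set (none initially). -/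
structure RoundChange (P V : Type*) where
  sender : P
  round : ℕ
  preNode : Node V
  cert : Option (LeadMsg P V)

/-- A signed `PROPOSE(r)` message with the new node and a certificate, consisting of signed
`ROUND-CHANGE` messages. -/
structure Proposal (P V : Type*) where
  sender : P
  round : ℕ
  node : Node V
  cert : Finset (RoundChange P V)

inductive Msg (P V : Type*)
  | roundChange (m : RoundChange P V)
  | propose (m : Proposal P V)
  | vote (m : Vote P V)
  | lead (m : LeadMsg P V)

namespace Msg

variable {P V : Type*}

def sender : Msg P V → P
  | roundChange m => m.sender
  | propose m => m.sender
  | vote m => m.sender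
  | lead m => m.sender

/-- The signed messages that a message carries in its certificate. -/
def attached : Msg P V → Set (Msg P V)
  | roundChange m => {x | ∃ y, m.cert = some y ∧ x = lead y}
  | propose m => {x | ∃ y ∈ m.cert, x = roundChange y}
  | vote _ => ∅
  | lead m => {x | ∃ y ∈ m.cert, x = vote y}

end Msg

/-- The parameters of the protocol: the fault bound, the Byzantine processes, and the fixed
assignment of leaders to rounds. -/
structure Config (P : Type*) where
  f : ℕ
  byz : Finset P
  leader : ℕ → P

/-- Quorums consist of at least `2f + 1` processes. -/
def Config.Quorum {P : Type*} (C : Config P) (Q : Finset P) : Prop := 2 * C.f + 1 ≤ Q.card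

/-- A `PRECOMMIT(r)` (`COMMIT(r)`, `DECIDE(r)`) message is valid when its certificate has the
`JOIN(r)` (`PRECOMMIT_VOTE(r)`, `COMMIT_VOTE(r)`) messages, with the same node, of a quorum. -/
def LeadMsg.Valid {P V : Type*} (C : Config P) (m : LeadMsg P V) : Prop :=
  ∃ Q : Finset P, C.Quorum Q ∧ ∀ q ∈ Q, (⟨q, m.kind.votes, m.round, m.node⟩ : Vote P V) ∈ m.cert

/-- The `preNode` of a `ROUND-CHANGE` message is certified: it is the genesis node, or the message
carries a valid `PRECOMMIT` message with this node. -/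
def RoundChange.Valid {P V : Type*} (C : Config P) (m : RoundChange P V) : Prop :=
  m.preNode = Node.genesis ∨
    ∃ y, m.cert = some y ∧ y.kind = LeadKind.precommit ∧ y.Valid C ∧ y.node = m.preNode

/-- A `PROPOSE(r)` message is valid when its certificate consists of `ROUND-CHANGE(r)` messages
with certified `preNode`s, including one from each member of a quorum, and its node has round `r`
and is a child of a `preNode` of highest round among them. -/
def Proposal.Valid {P V : Type*} (C : Config P) (m : Proposal P V) : Prop :=
  (∀ x ∈ m.cert, x.round = m.round ∧ x.Valid C) ∧
  (∃ Q : Finset P, C.Quorum Q ∧ ∀ q ∈ Q, ∃ x ∈ m.cert, x.sender = q) ∧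
  ∃ x ∈ m.cert, (∀ y ∈ m.cert, y.preNode.round ≤ x.preNode.round) ∧
    ∃ v : V, m.node = Node.block m.round v x.preNode

/-- Local state of a process: its current round (`0` before its first round), the nodes `preNode`
(with the `PRECOMMIT` message that certifies it), `votedNode` and `decidedNode`. -/
structure Local (P V : Type*) where
  round : ℕ
  preNode : Node V
  preCert : Option (LeadMsg P V)
  votedNode : Node V
  decidedNode : Node V

/-- A global state: the local states and the messages sent so far. Messages are never removed, so
they may be received late, repeatedly, in any order, or never. -/
structure State (P V : Type*) where
  loc : P → Local P V
  sent : Set (Msg P V)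

def State.init (P V : Type*) : State P V where
  loc := fun _ => ⟨0, Node.genesis, none, Node.genesis, Node.genesis⟩
  sent := ∅

open Classical in
/-- Process `p` changes its local state to `l`. -/
noncomputable def State.setLocal {P V : Type*} (s : State P V) (p : P) (l : Local P V) :
    State P V where
  loc := Function.update s.loc p l
  sent := s.sent

/-- The message `m` is sent. -/
def State.post {P V : Type*} (s : State P V) (m : Msg P V) : State P V where
  loc := s.loc
  sent := insert m s.sent

/-- Actions: sending a message (possibly upon receiving some), or updating `decidedNode`. -/
inductive Action (P V : Type*)
  | send (m : Msg P V)
  | decided (p : P) (n : Node V)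

/-- Process `p` may vote for node `n` in the phase of the votes of kind `k`: the node is of the
current round of `p`, which is a proper round, and `p` has not voted in this or a later phase of
the round. -/
def State.CanVote {P V : Type*} (s : State P V) (p : P) (k : VoteKind) (n : Node V) : Prop :=
  0 < (s.loc p).round ∧ n.round = (s.loc p).round ∧
    ∀ w : Vote P V, Msg.vote w ∈ s.sent → w.sender = p → w.round = (s.loc p).round →
      w.kind.rank < k.rank

/-- Process `p` receives a valid message `m` of kind `k` from the leader of its current round. -/
def State.Receives {P V : Type*} (C : Config P) (s : State P V) (p : P) (k : LeadKind)
    (m : LeadMsg P V) : Prop :=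
  Msg.lead m ∈ s.sent ∧ m.kind = k ∧ m.round = (s.loc p).round ∧ m.sender = C.leader m.round ∧
    m.Valid C

inductive Step {P V : Type*} (C : Config P) : State P V → Action P V → State P V → Prop
  /-- `ROUND-CHANGE`: upon a timeout, which may happen at any time, a correct process sends its
  `preNode` for the next round and increments its round. -/
  | roundChange {s : State P V} {p : P} : p ∉ C.byz →
      Step C s
        (Action.send (Msg.roundChange
          ⟨p, (s.loc p).round + 1, (s.loc p).preNode, (s.loc p).preCert⟩))
        ((s.post (Msg.roundChange
          ⟨p, (s.loc p).round + 1, (s.loc p).preNode, (s.loc p).preCert⟩)).setLocal p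
            { s.loc p with round := (s.loc p).round + 1 })
  /-- `PROPOSE`: a correct leader broadcasts its only proposal for its current round, extending a
  certified `preNode` of highest round received from a quorum. -/
  | propose {s : State P V} {m : Proposal P V} : m.sender ∉ C.byz →
      C.leader m.round = m.sender → (s.loc m.sender).round = m.round → m.Valid C →
      (Msg.propose m).attached ⊆ s.sent →
      (∀ m' : Proposal P V, Msg.propose m' ∈ s.sent → m'.sender = m.sender →
        m'.round ≠ m.round) →
      Step C s (Action.send (Msg.propose m)) (s.post (Msg.propose m))
  /-- `JOIN`: a correct process receives a valid proposal from the leader of its current round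
  whose node extends its `votedNode`, or whose node has a parent of higher round than that. -/
  | join {s : State P V} {p : P} {m : Proposal P V} : p ∉ C.byz →
      Msg.propose m ∈ s.sent → m.round = (s.loc p).round → m.sender = C.leader m.round →
      m.Valid C → s.CanVote p VoteKind.join m.node →
      (m.node.Extends (s.loc p).votedNode ∨ (s.loc p).votedNode.round < m.node.parent.round) →
      Step C s (Action.send (Msg.vote ⟨p, VoteKind.join, m.round, m.node⟩))
        (s.post (Msg.vote ⟨p, VoteKind.join, m.round, m.node⟩))
  /-- `PRECOMMIT`, `COMMIT`, `DECIDE`: a correct leader that received the votes of a quorum, for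
  its current round and for the same node, broadcasts the node and the certificate, once. -/
  | lead {s : State P V} {m : LeadMsg P V} : m.sender ∉ C.byz →
      C.leader m.round = m.sender → (s.loc m.sender).round = m.round → m.Valid C →
      (Msg.lead m).attached ⊆ s.sent →
      (∀ m' : LeadMsg P V, Msg.lead m' ∈ s.sent → m'.sender = m.sender → m'.round = m.round →
        m'.kind ≠ m.kind) →
      Step C s (Action.send (Msg.lead m)) (s.post (Msg.lead m))
  /-- `PRECOMMIT_VOTE`: a correct process receives a valid `PRECOMMIT`, updates `preNode`. -/
  | precommitVote {s : State P V} {p : P} {m : LeadMsg P V} : p ∉ C.byz →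
      s.Receives C p LeadKind.precommit m → s.CanVote p VoteKind.precommitVote m.node →
      Step C s (Action.send (Msg.vote ⟨p, VoteKind.precommitVote, m.round, m.node⟩))
        ((s.post (Msg.vote ⟨p, VoteKind.precommitVote, m.round, m.node⟩)).setLocal p
          { s.loc p with preNode := m.node, preCert := some m })
  /-- `COMMIT_VOTE`: a correct process receives a valid `COMMIT`, updates `votedNode`. -/
  | commitVote {s : State P V} {p : P} {m : LeadMsg P V} : p ∉ C.byz →
      s.Receives C p LeadKind.commit m → s.CanVote p VoteKind.commitVote m.node →
      Step C s (Action.send (Msg.vote ⟨p, VoteKind.commitVote, m.round, m.node⟩))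
        ((s.post (Msg.vote ⟨p, VoteKind.commitVote, m.round, m.node⟩)).setLocal p
          { s.loc p with votedNode := m.node })
  /-- A correct process receives a valid `DECIDE`, updates `decidedNode`. -/
  | decided {s : State P V} {p : P} {m : LeadMsg P V} : p ∉ C.byz →
      s.Receives C p LeadKind.decide m → 0 < (s.loc p).round →
      m.node.round = (s.loc p).round →
      Step C s (Action.decided p m.node) (s.setLocal p { s.loc p with decidedNode := m.node })
  /-- A Byzantine process sends an arbitrary message under its own name. As signatures cannot be
  forged, the signed messages carried in certificates have to be messages that were sent. -/
  | byzantine {s : State P V} {m : Msg P V} : m.sender ∈ C.byz → m.attached ⊆ s.sent →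
      Step C s (Action.send m) (s.post m)

/-- The HotStuff protocol as a labeled transition system. -/
def lts {P : Type*} (V : Type*) (C : Config P) : LTS (State P V) (Action P V) where
  init := State.init P V
  step := Step C

/-! ### Linearization points -/

/-- The action `a` sends a valid message of kind `k` for round `r`. -/
def SendsValid {P V : Type*} (C : Config P) (k : LeadKind) (r : ℕ) (a : Action P V) : Prop :=
  ∃ m : LeadMsg P V, a = Action.send (Msg.lead m) ∧ m.kind = k ∧ m.round = r ∧ m.Valid C

/-- The action `a`, coming after the actions `past`, is the first that sends a valid message of
kind `k` for round `r`. -/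
def FirstValid {P V : Type*} (C : Config P) (past : List (Action P V)) (k : LeadKind) (r : ℕ)
    (a : Action P V) : Prop :=
  SendsValid C k r a ∧ ∀ b ∈ past, ¬ SendsValid C k r b

open Classical in
/-- The successful QTree invocation, if any, whose linearization point is the action `a`, coming
after the actions `past`. The first valid `PRECOMMIT(r)` with a node of value `v` and parent `n'` is
the linearization point of `add(r, v, n'.round)`, and the first valid `DECIDE(r)` that of
`commit(r)`. (No correct process votes for the genesis node, so that it has no certificate.) -/
noncomputable def linPoint {P V : Type*} (C : Config P) (past : List (Action P V)) :
    Action P V → Option (QTree.Label V)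
  | Action.send (Msg.lead ⟨p, LeadKind.precommit, r, Node.block r₀ v n', cert⟩) =>
      if FirstValid C past LeadKind.precommit r
          (Action.send (Msg.lead ⟨p, LeadKind.precommit, r, Node.block r₀ v n', cert⟩))
      then some (QTree.Label.add r v n'.round QTree.Ret.ok) else none
  | Action.send (Msg.lead ⟨p, LeadKind.decide, r, n, cert⟩) =>
      if FirstValid C past LeadKind.decide r
          (Action.send (Msg.lead ⟨p, LeadKind.decide, r, n, cert⟩))
      then some (QTree.Label.commit r QTree.Ret.ok) else none
  | _ => none

/-- The invocations linearized along a sequence of actions that comes after the actions `past`. -/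
noncomputable def linearizeFrom {P V : Type*} (C : Config P) :
    List (Action P V) → List (Action P V) → List (QTree.Label V)
  | _, [] => []
  | past, a :: t => (linPoint C past a).toList ++ linearizeFrom C (past ++ [a]) t

/-- The sequence of QTree invocations defined by the linearization points along a trace. -/
noncomputable def linearize {P V : Type*} (C : Config P) (t : List (Action P V)) :
    List (QTree.Label V) :=
  linearizeFrom C [] t

end HotStuff

/-! Call a node precommitted (decided) once a valid `PRECOMMIT` (`DECIDE`) for it has been sent, by
anyone, and let A and D be the sets of these nodes. The protocol enters the simulation only through
A and D being `Coherent`: A is closed under parents up to genesis, parents have smaller rounds, each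
round has at most one node, D ⊆ A, and (safety) a precommitted node extends every decided node of
smaller or equal round.

Safety, `Inv.extends_decided`, is a strong induction on the round of the precommitted node n. The
joins for n and the commit votes for the decided node c come from quorums sharing a correct process.
If n has the higher round, the lock l of that process when it joined has a round in [c.round,
n.round), and either n extends l or the parent of n has a round above that of l. So l or the parent
is a precommitted node to which the induction hypothesis applies. This needs `Inv.parent_round_lt`,
which is not checked by the protocol and follows from another quorum argument.

On the tree side, `IsView` says that the nodes are those of A, the committed ones those of D (plus
the root), and that every ghost is bypassed by a node of higher round not extending it. Safety
forbids a decided node to be bypassed, so `commit` succeeds; it also puts a new node below the last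
committed one unless its round is smaller, so `add` succeeds. `exists_view` carries this along a
run. -/

namespace HotStuff

variable {P V : Type*}

/-! ### Ancestry of command nodes -/

namespace Node

theorem Extends.trans {a b c : Node V} (h : a.Extends b) (h' : b.Extends c) : a.Extends c := by
  induction h with
  | refl => exact h'
  | step _ ih => exact (ih h').step

theorem extends_genesis (n : Node V) : n.Extends genesis := by
  induction n with
  | genesis => exact .refl _
  | block r v p ih => exact ih.step

theorem Extends.of_parent {n m : Node V} (h : n.parent.Extends m) (hn : n ≠ genesis) :
    n.Extends m := by
  cases n with
  | genesis => exact absurd rfl hn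
  | block r v p => exact .step h

theorem Extends.eq_or_parent {n m : Node V} (h : n.Extends m) : n = m ∨ n.parent.Extends m := by
  cases h with
  | refl => exact .inl rfl
  | step h => exact .inr h

end Node

/-! ### Invariants of reachable states -/

/-- A valid message of kind `k` with node `n` has been sent. -/
def Announced (C : Config P) (s : State P V) (k : LeadKind) (n : Node V) : Prop :=
  ∃ m : LeadMsg P V, Msg.lead m ∈ s.sent ∧ m.kind = k ∧ m.Valid C ∧ m.node = n

theorem Announced.mono {C : Config P} {s s' : State P V} (h : s.sent ⊆ s'.sent) {k : LeadKind}
    {n : Node V} (hn : Announced C s k n) : Announced C s' k n := by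
  obtain ⟨m, hm, h'⟩ := hn
  exact ⟨m, h hm, h'⟩

/-- The invariants of the protocol. -/
structure Inv (C : Config P) (s : State P V) : Prop where
  attached_subset : ∀ m ∈ s.sent, m.attached ⊆ s.sent
  preCert_sent : ∀ p ∉ C.byz, ∀ m, (s.loc p).preCert = some m → Msg.lead m ∈ s.sent
  vote_round : ∀ w : Vote P V, Msg.vote w ∈ s.sent → w.sender ∉ C.byz →
    w.node.round = w.round ∧ 0 < w.round ∧ w.round ≤ (s.loc w.sender).round
  join_unique : ∀ w w' : Vote P V, Msg.vote w ∈ s.sent → Msg.vote w' ∈ s.sent →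
    w.sender ∉ C.byz → w'.sender = w.sender → w.kind = .join → w'.kind = .join →
    w'.round = w.round → w'.node = w.node
  join_parent : ∀ w : Vote P V, Msg.vote w ∈ s.sent → w.sender ∉ C.byz → w.kind = .join →
    w.node.parent = .genesis ∨ Announced C s .precommit w.node.parent
  vote_announced : ∀ w : Vote P V, Msg.vote w ∈ s.sent → w.sender ∉ C.byz → w.kind ≠ .join →
    Announced C s .precommit w.node
  /-- If a join is for a node whose round does not exceed that of its parent, then a quorum joined
  for the parent, and its correct members did not join for the node. -/
  join_parent_round : ∀ w : Vote P V, Msg.vote w ∈ s.sent → w.sender ∉ C.byz → w.kind = .join →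
    w.node.round ≤ w.node.parent.round → ∃ Q : Finset P, C.Quorum Q ∧
      (∀ q ∈ Q, Msg.vote ⟨q, .join, w.node.parent.round, w.node.parent⟩ ∈ s.sent) ∧
      ∀ q ∈ Q, q ∉ C.byz → Msg.vote ⟨q, .join, w.node.round, w.node⟩ ∉ s.sent
  -- Together with `le_votedNode`: the lock is a node of highest round among those the process cast
  -- a commit vote for.
  votedNode_sent : ∀ p ∉ C.byz, (s.loc p).votedNode = .genesis ∨
    Msg.vote ⟨p, .commitVote, (s.loc p).votedNode.round, (s.loc p).votedNode⟩ ∈ s.sent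
  le_votedNode : ∀ w : Vote P V, Msg.vote w ∈ s.sent → w.sender ∉ C.byz →
    w.kind = .commitVote → w.round ≤ (s.loc w.sender).votedNode.round
  /-- A process that cast a commit vote joins later rounds only for nodes that respect the lock. -/
  join_locked : ∀ w w' : Vote P V, Msg.vote w ∈ s.sent → Msg.vote w' ∈ s.sent →
    w.sender ∉ C.byz → w'.sender = w.sender → w.kind = .join → w'.kind = .commitVote →
    w'.round < w.round → ∃ n, Announced C s .precommit n ∧ w'.round ≤ n.round ∧
      n.round < w.round ∧ (w.node.Extends n ∨ n.round < w.node.parent.round)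

/-! ### Quorum intersection -/

section Quorum

variable {C : Config P}

theorem Config.Quorum.exists_correct (hbyz : C.byz.card ≤ C.f) {Q : Finset P} (hQ : C.Quorum Q) :
    ∃ q ∈ Q, q ∉ C.byz := by
  by_contra! h
  have := Finset.card_le_card (show Q ⊆ C.byz from h)
  unfold Config.Quorum at hQ
  omega

/-- Two quorums share at least 2(2f+1) - (3f+1) = f+1 processes, one more than can be Byzantine. -/
theorem Config.Quorum.exists_correct_inter [Fintype P] (hN : Fintype.card P = 3 * C.f + 1)
    (hbyz : C.byz.card ≤ C.f) {Q Q' : Finset P} (hQ : C.Quorum Q) (hQ' : C.Quorum Q') :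
    ∃ q, q ∈ Q ∧ q ∈ Q' ∧ q ∉ C.byz := by
  classical
  by_contra! h
  have h₁ := Finset.card_le_card (show Q ∩ Q' ⊆ C.byz from fun q hq =>
    h q (Finset.mem_inter.1 hq).1 (Finset.mem_inter.1 hq).2)
  have h₂ := Finset.card_union_add_card_inter Q Q'
  have h₃ := Finset.card_le_univ (Q ∪ Q')
  unfold Config.Quorum at hQ hQ'
  omega

end Quorum

/-! ### Consequences of the invariants, up to safety -/

namespace Inv

variable {C : Config P} {s : State P V}

theorem votes_sent (hs : Inv C s) {m : LeadMsg P V} (hm : Msg.lead m ∈ s.sent)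
    (hv : m.Valid C) : ∃ Q : Finset P, C.Quorum Q ∧
      ∀ q ∈ Q, Msg.vote ⟨q, m.kind.votes, m.round, m.node⟩ ∈ s.sent := by
  obtain ⟨Q, hQ, h⟩ := hv
  exact ⟨Q, hQ, fun q hq => hs.attached_subset _ hm ⟨_, h q hq, rfl⟩⟩

section

variable (hbyz : C.byz.card ≤ C.f)
include hbyz

/-- A correct member of the certifying quorum checked the round. This is why `Announced` need not
mention the round of the message. -/
theorem node_round (hs : Inv C s) {m : LeadMsg P V} (hm : Msg.lead m ∈ s.sent)
    (hv : m.Valid C) : m.node.round = m.round ∧ 0 < m.round := by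
  obtain ⟨Q, hQ, h⟩ := hs.votes_sent hm hv
  obtain ⟨q, hq, hc⟩ := hQ.exists_correct hbyz
  have := hs.vote_round _ (h q hq) hc
  exact ⟨this.1, this.2.1⟩

theorem quorum_of_announced (hs : Inv C s) {k : LeadKind} {n : Node V}
    (hn : Announced C s k n) : ∃ Q : Finset P, C.Quorum Q ∧
      ∀ q ∈ Q, Msg.vote ⟨q, k.votes, n.round, n⟩ ∈ s.sent := by
  obtain ⟨m, hm, rfl, hv, rfl⟩ := hn
  rw [(hs.node_round hbyz hm hv).1]
  exact hs.votes_sent hm hv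

theorem round_pos (hs : Inv C s) {k : LeadKind} {n : Node V} (hn : Announced C s k n) :
    0 < n.round := by
  obtain ⟨m, hm, -, hv, rfl⟩ := hn
  have := hs.node_round hbyz hm hv
  omega

/-- A certificate of a later phase contains a vote of a correct process, which is cast only for
precommitted nodes. -/
theorem announced_precommit (hs : Inv C s) {k : LeadKind} {n : Node V}
    (hn : Announced C s k n) : Announced C s .precommit n := by
  by_cases hk : k = .precommit
  · exact hk ▸ hn
  obtain ⟨Q, hQ, h⟩ := hs.quorum_of_announced hbyz hn
  obtain ⟨q, hq, hc⟩ := hQ.exists_correct hbyz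
  exact hs.vote_announced _ (h q hq) hc (by cases k <;> simp_all [LeadKind.votes])

theorem parent_announced (hs : Inv C s) {n : Node V} (hn : Announced C s .precommit n) :
    n.parent = .genesis ∨ Announced C s .precommit n.parent := by
  obtain ⟨Q, hQ, h⟩ := hs.quorum_of_announced hbyz hn
  obtain ⟨q, hq, hc⟩ := hQ.exists_correct hbyz
  exact hs.join_parent _ (h q hq) hc rfl

variable [Fintype P] (hN : Fintype.card P = 3 * C.f + 1)
include hN

theorem announced_unique (hs : Inv C s) {n n' : Node V} (hn : Announced C s .precommit n)
    (hn' : Announced C s .precommit n') (h : n.round = n'.round) : n = n' := by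
  obtain ⟨Q, hQ, hv⟩ := hs.quorum_of_announced hbyz hn
  obtain ⟨Q', hQ', hv'⟩ := hs.quorum_of_announced hbyz hn'
  obtain ⟨q, hq, hq', hc⟩ := hQ.exists_correct_inter hN hbyz hQ'
  exact hs.join_unique _ _ (hv' q hq') (hv q hq) hc rfl rfl rfl h

/-- A Byzantine `ROUND-CHANGE` may carry a `PRECOMMIT` of a round that is too high, so a correct
process may join for a node with a bad parent. But then `join_parent_round` gives a quorum whose
correct members have not joined for the node, and it meets every quorum of joins. -/
theorem parent_round_lt (hs : Inv C s) {n : Node V} (hn : Announced C s .precommit n) :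
    n.parent.round < n.round := by
  by_contra! hlt
  obtain ⟨Q, hQ, hv⟩ := hs.quorum_of_announced hbyz hn
  obtain ⟨q₀, hq₀, hc₀⟩ := hQ.exists_correct hbyz
  obtain ⟨Q', hQ', -, hv'⟩ := hs.join_parent_round _ (hv q₀ hq₀) hc₀ rfl hlt
  obtain ⟨q, hq, hq', hc⟩ := hQ.exists_correct_inter hN hbyz hQ'
  exact hv' q hq' hc (hv q hq)

/-- Safety: a precommitted node extends every decided node of smaller or equal round. -/
theorem extends_decided (hs : Inv C s) {c : Node V} (hc : Announced C s .decide c) {n : Node V}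
    (hn : Announced C s .precommit n) (hle : c.round ≤ n.round) : n.Extends c := by
  induction hr : n.round using Nat.strong_induction_on generalizing n with
  | _ r ih =>
  subst hr
  rcases hle.eq_or_lt with heq | hlt
  · rw [hs.announced_unique hbyz hN hn (hs.announced_precommit hbyz hc) heq.symm]
    exact .refl _
  have hn0 : n ≠ .genesis := by
    rintro rfl
    simp [Node.round] at hlt
  obtain ⟨Q, hQ, hv⟩ := hs.quorum_of_announced hbyz hn
  obtain ⟨Q', hQ', hv'⟩ := hs.quorum_of_announced hbyz hc
  obtain ⟨q, hq, hq', hqc⟩ := hQ.exists_correct_inter hN hbyz hQ'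
  obtain ⟨l, hl, hcl, hln, h⟩ := hs.join_locked _ _ (hv q hq) (hv' q hq') hqc rfl rfl rfl hlt
  -- Either the lock or the parent of `n` is a precommitted node of round at least `c.round` and
  -- below `n.round`.
  rcases h with h | h
  · exact h.trans (ih _ hln hl hcl rfl)
  · have hpr := hs.parent_round_lt hbyz hN hn
    rcases hs.parent_announced hbyz hn with hp | hp
    · simp [hp, Node.round] at h
    · exact Node.Extends.of_parent (ih _ hpr hp (hcl.trans h.le) rfl) hn0

end

/-! ### Preservation -/

theorem initial (C : Config P) : Inv C (State.init P V) := by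
  constructor <;> simp [State.init]

/-- Steps in which no correct process votes preserve the invariants. -/
theorem frame {s' : State P V} (hs : Inv C s) (hsub : s.sent ⊆ s'.sent)
    (hnew : ∀ m ∈ s'.sent, m ∈ s.sent ∨ m.attached ⊆ s.sent ∧
      ∀ w, m = Msg.vote w → w.sender ∈ C.byz)
    (hround : ∀ p, (s.loc p).round ≤ (s'.loc p).round)
    (hpre : ∀ p, (s'.loc p).preCert = (s.loc p).preCert)
    (hvoted : ∀ p, (s'.loc p).votedNode = (s.loc p).votedNode) : Inv C s' := by
  have hv : ∀ w : Vote P V, Msg.vote w ∈ s'.sent → w.sender ∉ C.byz → Msg.vote w ∈ s.sent := by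
    intro w hw hc
    rcases hnew _ hw with h | h
    · exact h
    · exact absurd (h.2 w rfl) hc
  constructor
  · intro m hm
    rcases hnew m hm with h | h
    · exact (hs.attached_subset m h).trans hsub
    · exact h.1.trans hsub
  · intro p hp m hm
    exact hsub (hs.preCert_sent p hp m (hpre p ▸ hm))
  · intro w hw hc
    obtain ⟨h₁, h₂, h₃⟩ := hs.vote_round w (hv w hw hc) hc
    exact ⟨h₁, h₂, h₃.trans (hround _)⟩
  · intro w w' hw hw' hc hss
    exact hs.join_unique w w' (hv w hw hc) (hv w' hw' (hss ▸ hc)) hc hss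
  · intro w hw hc hk
    exact (hs.join_parent w (hv w hw hc) hc hk).imp_right (Announced.mono hsub)
  · intro w hw hc hk
    exact (hs.vote_announced w (hv w hw hc) hc hk).mono hsub
  · intro w hw hc hk hle
    obtain ⟨Q, hQ, h₁, h₂⟩ := hs.join_parent_round w (hv w hw hc) hc hk hle
    exact ⟨Q, hQ, fun q hq => hsub (h₁ q hq), fun q hq hqc h => h₂ q hq hqc (hv _ h hqc)⟩
  · intro p hp
    rw [hvoted]
    exact (hs.votedNode_sent p hp).imp_right (@hsub _)
  · intro w hw hc hk
    rw [hvoted]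
    exact hs.le_votedNode w (hv w hw hc) hc hk
  · intro w w' hw hw' hc hss hk hk' hlt
    obtain ⟨n, hn, h⟩ := hs.join_locked w w' (hv w hw hc) (hv w' hw' (hss ▸ hc)) hc hss hk hk' hlt
    exact ⟨n, hn.mono hsub, h⟩

theorem join_step (hbyz : C.byz.card ≤ C.f) (hs : Inv C s) {p : P}
    {m : Proposal P V} (hp : p ∉ C.byz) (hm : Msg.propose m ∈ s.sent)
    (hr : m.round = (s.loc p).round) (hv : m.Valid C) (hcan : s.CanVote p .join m.node)
    (hlock : m.node.Extends (s.loc p).votedNode ∨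
      (s.loc p).votedNode.round < m.node.parent.round) :
    Inv C (s.post (Msg.vote ⟨p, .join, m.round, m.node⟩)) := by
  obtain ⟨hpos, hnr, hno⟩ := hcan
  -- `JOIN` has the least rank, so `CanVote` rules out every earlier vote in this round; votes never
  -- run ahead of the current round.
  have hnone : ∀ w : Vote P V, Msg.vote w ∈ s.sent → w.sender = p → w.round < m.round := by
    intro w hw hwp
    have h₁ := (hs.vote_round w hw (hwp ▸ hp)).2.2
    rw [hwp, ← hr] at h₁
    refine lt_of_le_of_ne h₁ fun h => ?_
    have h₂ := hno w hw hwp (h.trans hr)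
    cases hk : w.kind <;> simp [hk, VoteKind.rank] at h₂
  have hsub : s.sent ⊆ (s.post (Msg.vote ⟨p, .join, m.round, m.node⟩)).sent :=
    Set.subset_insert _ _
  -- The `PRECOMMIT` is nested two levels deep, in a `ROUND-CHANGE` inside the proposal;
  -- `attached_subset` unwraps both.
  have hpar : m.node.parent = .genesis ∨ Announced C s .precommit m.node.parent := by
    obtain ⟨hcert, -, x, hx, -, v, hnode⟩ := hv
    rw [hnode]
    refine (hcert x hx).2.imp id ?_
    rintro ⟨y, hy, hk, hyv, hyn⟩
    exact ⟨y, hs.attached_subset _ (hs.attached_subset _ hm ⟨x, hx, rfl⟩) ⟨y, hy, rfl⟩,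
      hk, hyv, hyn⟩
  have hmem : ∀ w : Vote P V, Msg.vote w ∈ (s.post (Msg.vote ⟨p, .join, m.round, m.node⟩)).sent →
      w = ⟨p, .join, m.round, m.node⟩ ∨ Msg.vote w ∈ s.sent := by
    intro w hw
    simpa [State.post] using hw
  constructor
  · rintro x (rfl | hx)
    · simp [Msg.attached]
    · exact (hs.attached_subset x hx).trans hsub
  · intro q hq x hx
    exact hsub (hs.preCert_sent q hq x hx)
  · intro w hw hc
    rcases hmem w hw with rfl | hw
    · exact ⟨hnr.trans hr.symm, hr ▸ hpos, hr.le⟩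
    · exact hs.vote_round w hw hc
  · intro w w' hw hw' hc hss hk hk' hrr
    rcases hmem w hw with rfl | hw <;> rcases hmem w' hw' with rfl | hw'
    · rfl
    · exact absurd hrr (hnone w' hw' hss).ne
    · exact absurd hrr (hnone w hw hss.symm).ne'
    · exact hs.join_unique w w' hw hw' hc hss hk hk' hrr
  · intro w hw hc hk
    rcases hmem w hw with rfl | hw
    · exact hpar.imp_right (Announced.mono hsub)
    · exact (hs.join_parent w hw hc hk).imp_right (Announced.mono hsub)
  · intro w hw hc hk
    rcases hmem w hw with rfl | hw
    · exact absurd rfl hk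
    · exact (hs.vote_announced w hw hc hk).mono hsub
  · have old : ∀ w : Vote P V, Msg.vote w ∈ s.sent → w.sender ∉ C.byz → w.kind = .join →
        w.node.round ≤ w.node.parent.round → ∃ Q : Finset P, C.Quorum Q ∧
          (∀ q ∈ Q, Msg.vote ⟨q, .join, w.node.parent.round, w.node.parent⟩ ∈
            (s.post (Msg.vote ⟨p, .join, m.round, m.node⟩)).sent) ∧
          ∀ q ∈ Q, q ∉ C.byz → Msg.vote ⟨q, .join, w.node.round, w.node⟩ ∉
            (s.post (Msg.vote ⟨p, .join, m.round, m.node⟩)).sent := by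
      intro w hw hc hk hle
      obtain ⟨Q, hQ, h₁, h₂⟩ := hs.join_parent_round w hw hc hk hle
      refine ⟨Q, hQ, fun q hq => hsub (h₁ q hq), fun q hq hqc h => ?_⟩
      rcases hmem _ h with h | h
      · simp only [Vote.mk.injEq, true_and] at h
        have := hnone _ (h₁ q hq) h.1
        simp only at this
        omega
      · exact h₂ q hq hqc h
    intro w hw hc hk hle
    rcases hmem w hw with rfl | hw
    · simp only at hle ⊢
      -- A quorum found at an earlier correct join remains good. At the first one, take the joins
      -- for the parent: `p` is not among their senders, since by `hnone` it has not voted in a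
      -- round this high.
      by_cases hex : ∃ q ∉ C.byz, Msg.vote ⟨q, .join, m.round, m.node⟩ ∈ s.sent
      · obtain ⟨q, hq, hqs⟩ := hex
        exact old _ hqs hq rfl hle
      · push Not at hex
        rcases hpar with hg | ha
        · have : (Node.genesis : Node V).round = 0 := rfl
          rw [hg] at hle
          omega
        · obtain ⟨Q, hQ, h⟩ := hs.quorum_of_announced hbyz ha
          refine ⟨Q, hQ, fun q hq => hsub (h q hq), fun q hq hqc hin => ?_⟩
          rcases hmem _ hin with h' | h'
          · simp only [Vote.mk.injEq, true_and] at h'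
            have := hnone _ (h q hq) h'.1
            simp only at this
            omega
          · rw [hnr, ← hr] at h'
            exact hex q hqc h'
    · exact old w hw hc hk hle
  · intro q hq
    exact (hs.votedNode_sent q hq).imp_right (@hsub _)
  · intro w hw hc hk
    rcases hmem w hw with rfl | hw
    · cases hk
    · exact hs.le_votedNode w hw hc hk
  · intro w w' hw hw' hc hss hk hk' hlt
    rcases hmem w' hw' with rfl | hw'
    · cases hk'
    rcases hmem w hw with rfl | hw
    · have hle := hs.le_votedNode w' hw' (hss ▸ hc) hk'
      have hpos' := (hs.vote_round w' hw' (hss ▸ hc)).2.1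
      simp only at hss
      rw [hss] at hle
      -- The witness is the lock at the moment of joining. It is not genesis, as its round is at
      -- least that of the positive-round vote `w'`.
      rcases hs.votedNode_sent p hp with hg | hg
      · have : (Node.genesis : Node V).round = 0 := rfl
        simp only [hg] at hle
        omega
      · exact ⟨_, (hs.vote_announced _ hg hp (by simp)).mono hsub, hle, hnone _ hg rfl, hlock⟩
    · obtain ⟨n, hn, h⟩ := hs.join_locked w w' hw hw' hc hss hk hk' hlt
      exact ⟨n, hn.mono hsub, h⟩

/-- A vote of a later phase for a node with a valid `PRECOMMIT` preserves the invariants, if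
the local state is updated accordingly. -/
theorem vote_step (hs : Inv C s) {p : P} {k : VoteKind} {r : ℕ} {n : Node V} {l : Local P V}
    (hp : p ∉ C.byz) (hk : k ≠ .join) (hn : Announced C s .precommit n)
    (hr : r = (s.loc p).round) (hcan : s.CanVote p k n)
    (hround : l.round = (s.loc p).round)
    (hpre : ∀ m, l.preCert = some m → Msg.lead m ∈ s.sent)
    (hvoted : k = .commitVote ∧ l.votedNode = n ∨
      k ≠ .commitVote ∧ l.votedNode = (s.loc p).votedNode) :
    Inv C ((s.post (Msg.vote ⟨p, k, r, n⟩)).setLocal p l) := by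
  obtain ⟨hpos, hnr, hno⟩ := hcan
  set s' := (s.post (Msg.vote ⟨p, k, r, n⟩)).setLocal p l with hs'
  have hsub : s.sent ⊆ s'.sent := Set.subset_insert _ _
  have hmem : ∀ w : Vote P V, Msg.vote w ∈ s'.sent →
      w = ⟨p, k, r, n⟩ ∨ Msg.vote w ∈ s.sent := by
    intro w hw
    simpa [hs', State.post, State.setLocal] using hw
  have hlp : s'.loc p = l := by simp [hs', State.setLocal]
  have hlq : ∀ q, q ≠ p → s'.loc q = s.loc q := by
    intro q hq
    simp [hs', State.setLocal, State.post, hq]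
  have hrd : ∀ q, (s'.loc q).round = (s.loc q).round := by
    intro q
    by_cases hq : q = p
    · rw [hq, hlp, hround]
    · rw [hlq q hq]
  constructor
  · rintro x (rfl | hx)
    · simp [Msg.attached]
    · exact (hs.attached_subset x hx).trans hsub
  · intro q hq x hx
    by_cases hqp : q = p
    · rw [hqp, hlp] at hx
      exact hsub (hpre x hx)
    · rw [hlq q hqp] at hx
      exact hsub (hs.preCert_sent q hq x hx)
  · intro w hw hc
    rw [hrd]
    rcases hmem w hw with rfl | hw
    · exact ⟨hnr.trans hr.symm, hr ▸ hpos, hr.le⟩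
    · exact hs.vote_round w hw hc
  · intro w w' hw hw' hc hss hj hj'
    rcases hmem w hw with rfl | hw
    · exact absurd hj hk
    rcases hmem w' hw' with rfl | hw'
    · exact absurd hj' hk
    exact hs.join_unique w w' hw hw' hc hss hj hj'
  · intro w hw hc hj
    rcases hmem w hw with rfl | hw
    · exact absurd hj hk
    · exact (hs.join_parent w hw hc hj).imp_right (Announced.mono hsub)
  · intro w hw hc hj
    rcases hmem w hw with rfl | hw
    · exact hn.mono hsub
    · exact (hs.vote_announced w hw hc hj).mono hsub
  · intro w hw hc hj hle
    rcases hmem w hw with rfl | hw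
    · exact absurd hj hk
    obtain ⟨Q, hQ, h₁, h₂⟩ := hs.join_parent_round w hw hc hj hle
    refine ⟨Q, hQ, fun q hq => hsub (h₁ q hq), fun q hq hqc h => ?_⟩
    rcases hmem _ h with h | h
    · exact hk (Vote.mk.inj h).2.1.symm
    · exact h₂ q hq hqc h
  · intro q hq
    by_cases hqp : q = p
    · subst hqp
      rw [hlp]
      rcases hvoted with ⟨rfl, h⟩ | ⟨-, h⟩
      · right
        rw [h, hnr, ← hr]
        exact Set.mem_insert _ _
      · rw [h]
        exact (hs.votedNode_sent q hq).imp_right (@hsub _)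
    · rw [hlq q hqp]
      exact (hs.votedNode_sent q hq).imp_right (@hsub _)
  · intro w hw hc hcv
    rcases hmem w hw with rfl | hw
    · simp only at hcv ⊢
      rw [hlp]
      rcases hvoted with ⟨-, h⟩ | ⟨h, -⟩
      · rw [h, hnr, hr]
      · exact absurd hcv h
    · by_cases hqp : w.sender = p
      · rw [hqp, hlp]
        rcases hvoted with ⟨-, h⟩ | ⟨-, h⟩
        · rw [h, hnr, ← hqp]
          exact (hs.vote_round w hw hc).2.2
        · rw [h, ← hqp]
          exact hs.le_votedNode w hw hc hcv
      · rw [hlq _ hqp]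
        exact hs.le_votedNode w hw hc hcv
  · intro w w' hw hw' hc hss hj hcv hlt
    rcases hmem w hw with rfl | hw
    · exact absurd hj hk
    rcases hmem w' hw' with rfl | hw'
    -- A fresh commit vote is in the current round, and its sender has no join in a later round yet.
    · have := (hs.vote_round w hw hc).2.2
      simp only at hss hlt
      rw [← hss, ← hr] at this
      omega
    obtain ⟨n, hn, h⟩ := hs.join_locked w w' hw hw' hc hss hj hcv hlt
    exact ⟨n, hn.mono hsub, h⟩

theorem step (hbyz : C.byz.card ≤ C.f) (hs : Inv C s) {a : Action P V}
    {s' : State P V} (h : Step C s a s') : Inv C s' := by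
  have post : ∀ m : Msg P V, m.attached ⊆ s.sent → (∀ w, m = Msg.vote w → w.sender ∈ C.byz) →
      Inv C (s.post m) := fun m h₁ h₂ =>
    hs.frame (Set.subset_insert _ _)
      (by
        rintro x (rfl | hx)
        · exact .inr ⟨h₁, h₂⟩
        · exact .inl hx)
      (fun _ => le_rfl) (fun _ => rfl) (fun _ => rfl)
  cases h with
  | @roundChange p hp =>
    refine hs.frame (Set.subset_insert _ _) ?_ ?_ ?_ ?_
    · rintro x (rfl | hx)
      · refine .inr ⟨?_, by simp⟩
        -- The stored certificate was itself received, hence sent.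
        rintro _ ⟨y, hy, rfl⟩
        exact hs.preCert_sent p hp y hy
      · exact .inl hx
    all_goals
      intro q
      by_cases hq : q = p
      · subst hq
        simp [State.setLocal]
      · simp [State.setLocal, State.post, hq]
  | propose _ _ _ _ hatt _ => exact post _ hatt (by simp)
  | join hp hm hr _ hv hcan hlock => exact hs.join_step hbyz hp hm hr hv hcan hlock
  | lead _ _ _ _ hatt _ => exact post _ hatt (by simp)
  | precommitVote hp hrec hcan =>
    obtain ⟨hm, hk, hr, -, hv⟩ := hrec
    refine hs.vote_step hp (by simp) ⟨_, hm, hk, hv, rfl⟩ hr hcan rfl ?_ (.inr ⟨by simp, rfl⟩)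
    rintro _ ⟨⟩
    exact hm
  | @commitVote p m hp hrec hcan =>
    obtain ⟨hm, hk, hr, -, hv⟩ := hrec
    exact hs.vote_step hp (by simp) (hs.announced_precommit hbyz ⟨_, hm, hk, hv, rfl⟩) hr hcan rfl
      (hs.preCert_sent p hp) (.inl ⟨rfl, rfl⟩)
  | @decided p m hp _ _ _ =>
    refine hs.frame subset_rfl (fun _ h => .inl h) ?_ ?_ ?_
    all_goals
      intro q
      by_cases hq : q = p
      · subst hq
        simp [State.setLocal]
      · simp [State.setLocal, hq]
  | @byzantine m hb hatt =>
    refine post m hatt ?_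
    rintro w rfl
    exact hb

end Inv

end HotStuff

/-! ### Simulation of coherent sets of nodes by the tree -/

namespace QTree

variable {α : Type*}

open HotStuff (Node)

/-- The tree `T` contains every node of `A`, with its parent. -/
def Represents (T : State α) (A : Set (Node α)) : Prop :=
  ∀ n ∈ A, ∃ e, T n.round = some e ∧ e.parent = n.parent.round

/-- Only this direction is needed: its contrapositive turns a conflict in the tree into
non-extension of nodes. -/
theorem Represents.extends {T : State α} {A : Set (Node α)} (hT : Represents T A)
    (hA : ∀ n ∈ A, n.parent = .genesis ∨ n.parent ∈ A) {n m : Node α} (hn : n ∈ A)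
    (h : n.Extends m) : Extends T n.round m.round := by
  induction h with
  | refl => exact .refl
  | step h ih =>
    refine .head (hT _ hn) ?_
    rcases hA _ hn with hp | hp
    · simp only [Node.parent] at hp ⊢
      subst hp
      cases h
      exact .refl
    · exact ih hp

/-- The tree `T` is a view of the protocol: its nodes are the genesis node and the nodes in `A`,
the committed ones are the genesis node and the nodes in `D`, and every ghost node is bypassed by a
node of higher round. -/
structure IsView (A D : Set (Node α)) (T : State α) : Prop where
  represents : Represents T A
  mem_of_ne_none : ∀ r, T r ≠ none → r = 0 ∨ ∃ n ∈ A, n.round = r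
  committed_iff : ∀ r, IsCommitted T r ↔ r = 0 ∨ ∃ n ∈ D, n.round = r
  bypassed : ∀ n ∈ A, ∀ e, T n.round = some e → e.status = .ghost →
    ∃ n' ∈ A, n.round < n'.round ∧ ¬ n'.Extends n
  exists_max : ∃ c, MaxCommitted T c

/-- The properties of sets of precommitted nodes and of decided nodes that make them
representable. -/
structure Coherent (A D : Set (Node α)) : Prop where
  round_pos : ∀ n ∈ A, 0 < n.round
  parent_mem : ∀ n ∈ A, n.parent = .genesis ∨ n.parent ∈ A
  parent_round_lt : ∀ n ∈ A, n.parent.round < n.round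
  unique : ∀ n ∈ A, ∀ m ∈ A, n.round = m.round → n = m
  decided_subset : D ⊆ A
  safe : ∀ c ∈ D, ∀ n ∈ A, c.round ≤ n.round → n.Extends c

theorem Coherent.mem_of_extends {A D : Set (Node α)} (h : Coherent A D) {n m : Node α}
    (hnm : n.Extends m) (hn : n ∈ A) : m = .genesis ∨ m ∈ A := by
  induction hnm with
  | refl => exact .inr hn
  | step hpm ih =>
    rcases h.parent_mem _ hn with hp | hp
    · simp only [Node.parent] at hp
      subst hp
      cases hpm
      exact .inl rfl
    · exact ih hp

theorem isView_init (α : Type*) : IsView (∅ : Set (Node α)) ∅ (init α) := by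
  have h : ∀ r, IsCommitted (init α) r ↔ r = 0 := by
    intro r
    by_cases hr : r = 0 <;> simp [IsCommitted, init, hr]
  refine ⟨by simp [Represents], ?_, by simpa using h, by simp, 0, (h 0).2 rfl, ?_⟩
  · intro r hr
    by_contra h0
    simp_all [init]
  · intro c hc
    exact ((h c).1 hc).le

/-- Coherence is assumed with `n` already decided: its safety clause contradicts the bypassing node
that a ghost `n` would have. -/
theorem IsView.commit {A D : Set (Node α)} {T : State α} (hT : IsView A D T) {n : Node α}
    (hco : Coherent A (insert n D)) (hn : n ∉ D) :
    Step T (.commit n.round .ok) (commitNode T n.round) ∧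
      IsView A (insert n D) (commitNode T n.round) := by
  have hnA : n ∈ A := hco.decided_subset (Set.mem_insert _ _)
  obtain ⟨e, he, hep⟩ := hT.represents n hnA
  have hst : e.status = .added := by
    rcases hs : e.status with _ | _ | _
    · rfl
    · obtain ⟨n', hn', hlt, hne⟩ := hT.bypassed n hnA e he hs
      exact absurd (hco.safe n (Set.mem_insert _ _) n' hn' hlt.le) hne
    · rcases (hT.committed_iff _).1 ⟨e, he, hs⟩ with h | ⟨m, hm, hmr⟩
      · have := hco.round_pos n hnA
        omega
      · rw [hco.unique m (hco.decided_subset (.inr hm)) n hnA hmr] at hm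
        exact absurd hm hn
  have hsame : commitNode T n.round n.round = some { e with status := .committed } := by
    simp [commitNode, he]
  have hother : ∀ r, r ≠ n.round → commitNode T n.round r = T r := by
    intro r hr
    simp [commitNode, hr]
  have hcom : ∀ r, IsCommitted (commitNode T n.round) r ↔ r = n.round ∨ IsCommitted T r := by
    intro r
    by_cases hr : r = n.round
    · subst hr
      simp [IsCommitted, hsame]
    · simp [IsCommitted, hother r hr, hr]
  refine ⟨.commit_ok ⟨e, he, hst⟩, ?_, ?_, ?_, ?_, ?_⟩
  · intro m hm
    by_cases hr : m.round = n.round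
    · rw [hr, hsame, hco.unique m hm n hnA hr]
      exact ⟨_, rfl, hep⟩
    · rw [hother _ hr]
      exact hT.represents m hm
  · intro r hr
    by_cases hrn : r = n.round
    · exact .inr ⟨n, hnA, hrn.symm⟩
    · rw [hother r hrn] at hr
      exact hT.mem_of_ne_none r hr
  · intro r
    rw [hcom, hT.committed_iff]
    simp only [Set.mem_insert_iff, exists_eq_or_imp, @eq_comm _ n.round r]
    tauto
  · intro m hm e' he' hg
    by_cases hr : m.round = n.round
    · rw [hr, hsame] at he'
      cases he'
      cases hg
    · rw [hother _ hr] at he'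
      exact hT.bypassed m hm e' he' hg
  · obtain ⟨c, hc, hmax⟩ := hT.exists_max
    refine ⟨max c n.round, ?_, ?_⟩
    · rw [hcom]
      rcases max_choice c n.round with h | h <;> rw [h]
      · exact .inr hc
      · exact .inl rfl
    · intro c' hc'
      rcases (hcom _).1 hc' with rfl | h
      · exact le_max_right _ _
      · exact (hmax _ h).trans (le_max_left _ _)

/-- Nodes may arrive out of round order, so the new node can have a smaller round than existing or
even committed ones. -/
theorem IsView.add {A D : Set (Node α)} {T : State α} (hT : IsView A D T) {r : ℕ} {v : α}
    {p : Node α} (hcoT : Coherent A D) (hco : Coherent (insert (.block r v p) A) D)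
    (hnew : ∀ m ∈ A, m.round ≠ r) :
    Step T (.add r v p.round .ok) (addNode T r v p.round) ∧
      IsView (insert (.block r v p) A) D (addNode T r v p.round) := by
  set n : Node α := .block r v p with hn
  have hnA : n ∈ insert n A := Set.mem_insert _ _
  have hnr : n.round = r := rfl
  have hnp : n.parent = p := rfl
  have hrpos : 0 < r := hco.round_pos n hnA
  have hplt : p.round < r := hco.parent_round_lt n hnA
  have hpA : p = .genesis ∨ p ∈ A := by
    rcases hco.parent_mem n hnA with h | h | h
    · exact .inl h
    · rw [hnp] at h
      rw [h, hnr] at hplt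
      exact absurd hplt (lt_irrefl _)
    · exact .inr h
  have hTr : T r = none := by
    by_contra h
    rcases hT.mem_of_ne_none r h with h | ⟨m, hm, h⟩
    · omega
    · exact hnew m hm h
  have hroot : ∃ e, T 0 = some e := by
    obtain ⟨e, he, -⟩ := (hT.committed_iff 0).2 (.inl rfl)
    exact ⟨e, he⟩
  have hvalid : Valid T r p.round := by
    refine ⟨⟨?_, hplt⟩, hTr, ?_⟩
    · rcases hpA with h | h
      · rw [h]
        exact hroot
      · obtain ⟨e, he, -⟩ := hT.represents p h
        exact ⟨e, he⟩
    · obtain ⟨c, hc⟩ := hT.exists_max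
      refine ⟨c, hc, ?_⟩
      have key : ∀ m : Node α, p.Extends m → Extends T p.round m.round := by
        intro m hm
        rcases hpA with h | h
        · subst h
          cases hm
          exact .refl
        · exact hT.represents.extends hcoT.parent_mem h hm
      rcases (hT.committed_iff c).1 hc.1 with h | ⟨m, hm, h⟩
      · subst h
        exact .inl (key _ (Node.extends_genesis p))
      · subst h
        by_cases hlt : r < m.round
        · exact .inr hlt
        -- Safety gives that `n` extends `m`; as `m` is an old node, the path passes through the
        -- parent `p`.
        · rcases (hco.safe m hm n hnA (not_lt.1 hlt)).eq_or_parent with h | h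
          · exact absurd (congrArg Node.round h.symm) (hnew m (hcoT.decided_subset hm))
          · exact .inl (key m h)
  have hatt : Represents (attach T r v p.round (newStatus T r)) (insert n A) := by
    rintro m (rfl | hm)
    · exact ⟨⟨newStatus T r, some v, p.round⟩, by simp [attach, hnr], rfl⟩
    · simpa [attach, hnew m hm] using hT.represents m hm
  have hsame : addNode T r v p.round r = some ⟨newStatus T r, some v, p.round⟩ := by
    simp [addNode, invalidate, attach]
  have hother : ∀ x, x ≠ r → addNode T r v p.round x = T x ∨
      x < r ∧ Conflicting (attach T r v p.round (newStatus T r)) r x ∧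
      addNode T r v p.round x = (T x).map fun e => { e with status := .ghost } := by
    intro x hx
    by_cases h : x < r ∧ Conflicting (attach T r v p.round (newStatus T r)) r x
    · exact .inr ⟨h.1, h.2, by simp only [addNode, invalidate, if_pos h]; simp [attach, hx]⟩
    · exact .inl (by simp only [addNode, invalidate, if_neg h]; simp [attach, hx])
  have hconf : ∀ m : Node α, Conflicting (attach T r v p.round (newStatus T r)) r m.round →
      ¬ n.Extends m := fun m hm h => hm.1 (hatt.extends hco.parent_mem hnA h)
  -- A node born as a ghost is bypassed by any older node of higher round: `A` was closed under
  -- ancestors and did not contain `n`.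
  have hstatus : newStatus T r = .added ∨
      newStatus T r = .ghost ∧ ∃ m ∈ A, r < m.round ∧ ¬ m.Extends n := by
    by_cases h : ∃ r', r < r' ∧ T r' ≠ none
    · refine .inr ⟨by simp only [newStatus, if_pos h], ?_⟩
      obtain ⟨r', hlt, hne⟩ := h
      rcases hT.mem_of_ne_none r' hne with h | ⟨m, hm, rfl⟩
      · omega
      · refine ⟨m, hm, hlt, fun hext => ?_⟩
        rcases hcoT.mem_of_extends hext hm with h | h
        · simp [hn] at h
        · exact hnew n h rfl
    · exact .inl (by simp only [newStatus, if_neg h])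
  have hcom : ∀ x, IsCommitted (addNode T r v p.round) x ↔ IsCommitted T x := by
    intro x
    by_cases hx : x = r
    · subst hx
      rcases hstatus with h | ⟨h, -⟩ <;> simp [IsCommitted, hsame, hTr, h]
    · rcases hother x hx with h | ⟨hlt, hc, h⟩
      · simp [IsCommitted, h]
      -- Invalidation never hits a committed node, since by safety the new node extends all those of
      -- smaller round.
      · have h₁ : ¬ IsCommitted T x := by
          intro hxc
          rcases (hT.committed_iff x).1 hxc with h0 | ⟨m, hm, rfl⟩
          · subst h0
            exact hconf .genesis hc (Node.extends_genesis n)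
          · exact hconf m hc (hco.safe m hm n hnA hlt.le)
        refine iff_of_false ?_ h₁
        rintro ⟨e, he, hec⟩
        rw [h, Option.map_eq_some_iff] at he
        obtain ⟨_, _, rfl⟩ := he
        cases hec
  refine ⟨.add_ok hrpos hvalid, ?_, ?_, ?_, ?_, ?_⟩
  · rintro m (rfl | hm)
    · exact ⟨_, hsame, rfl⟩
    · obtain ⟨e, he, hep⟩ := hT.represents m hm
      rcases hother _ (hnew m hm) with h | ⟨-, -, h⟩
      · exact ⟨e, h.trans he, hep⟩
      · exact ⟨{ e with status := .ghost }, by rw [h, he]; rfl, hep⟩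
  · intro x hx
    by_cases hxr : x = r
    · exact .inr ⟨n, hnA, hxr.symm⟩
    · have hTx : T x ≠ none := by
        rcases hother x hxr with h | ⟨-, -, h⟩
        · rwa [h] at hx
        · rwa [h, ne_eq, Option.map_eq_none_iff] at hx
      exact (hT.mem_of_ne_none x hTx).imp_right fun ⟨m, hm, h⟩ => ⟨m, .inr hm, h⟩
  · intro x
    rw [hcom, hT.committed_iff]
  · rintro m (rfl | hm) e he hg
    · rw [hnr, hsame] at he
      cases he
      rcases hstatus with h | ⟨-, m, hm, h⟩
      · simp [h] at hg
      · exact ⟨m, .inr hm, h⟩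
    · rcases hother _ (hnew m hm) with h | ⟨hlt, hc, -⟩
      · rw [h] at he
        obtain ⟨m', hm', h'⟩ := hT.bypassed m hm e he hg
        exact ⟨m', .inr hm', h'⟩
      · exact ⟨n, hnA, hlt, hconf m hc⟩
  · obtain ⟨c, hc, hmax⟩ := hT.exists_max
    exact ⟨c, (hcom c).2 hc, fun c' hc' => hmax c' ((hcom c').1 hc')⟩

end QTree

/-! ### Simulation along a run of the protocol -/

namespace HotStuff

variable {P V : Type*}

theorem Inv.coherent [Fintype P] {C : Config P} {s : State P V} (hs : Inv C s)
    (hN : Fintype.card P = 3 * C.f + 1) (hbyz : C.byz.card ≤ C.f) :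
    QTree.Coherent {n | Announced C s .precommit n} {n | Announced C s .decide n} where
  round_pos _ := hs.round_pos hbyz
  parent_mem _ := hs.parent_announced hbyz
  parent_round_lt _ := hs.parent_round_lt hbyz hN
  unique _ hn _ hm := hs.announced_unique hbyz hN hn hm
  decided_subset _ := hs.announced_precommit hbyz
  safe _ hc _ := hs.extends_decided hbyz hN hc

theorem Step.sent_iff {C : Config P} {s s' : State P V} {a : Action P V} (h : Step C s a s')
    (m : Msg P V) : m ∈ s'.sent ↔ m ∈ s.sent ∨ Action.send m = a := by
  cases h <;> simp [State.post, State.setLocal, or_comm]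

theorem run_sent_iff {C : Config P} {t : List (Action P V)} {s : State P V}
    (h : (lts V C).Run t s) (m : Msg P V) : m ∈ s.sent ↔ Action.send m ∈ t := by
  induction h with
  | nil => simp [lts, State.init]
  | snoc _ hstep ih => rw [Step.sent_iff hstep, ih, List.mem_append, List.mem_singleton]

theorem run_inv {C : Config P} (hbyz : C.byz.card ≤ C.f) {t : List (Action P V)} {s : State P V}
    (h : (lts V C).Run t s) : Inv C s := by
  induction h with
  | nil => exact Inv.initial C
  | snoc _ hstep ih => exact ih.step hbyz hstep

theorem linearizeFrom_append {C : Config P} (past t : List (Action P V)) (a : Action P V) :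
    linearizeFrom C past (t ++ [a]) =
      linearizeFrom C past t ++ (linPoint C (past ++ t) a).toList := by
  induction t generalizing past with
  | nil => simp [linearizeFrom]
  | cons b t ih => simp [linearizeFrom, ih]

theorem linearize_append {C : Config P} (t : List (Action P V)) (a : Action P V) :
    linearize C (t ++ [a]) = linearize C t ++ (linPoint C t a).toList := by
  simp [linearize, linearizeFrom_append]

theorem exists_sendsValid_iff {C : Config P} {t : List (Action P V)} {s : State P V}
    (h : (lts V C).Run t s) (k : LeadKind) (r : ℕ) :
    (∃ b ∈ t, SendsValid C k r b) ↔
      ∃ m : LeadMsg P V, Msg.lead m ∈ s.sent ∧ m.kind = k ∧ m.round = r ∧ m.Valid C := by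
  simp only [run_sent_iff h]
  constructor
  · rintro ⟨_, hb, m, rfl, hm⟩
    exact ⟨m, hb, hm⟩
  · rintro ⟨m, hb, hm⟩
    exact ⟨_, hb, m, rfl, hm⟩

theorem announced_step_iff {C : Config P} {s s' : State P V} {a : Action P V}
    (h : Step C s a s') (k : LeadKind) (n : Node V) : Announced C s' k n ↔ Announced C s k n ∨
      ∃ m : LeadMsg P V, a = .send (.lead m) ∧ m.kind = k ∧ m.Valid C ∧ m.node = n := by
  simp only [Announced, h.sent_iff, or_and_right, exists_or, eq_comm (a := a)]

theorem exists_view [Fintype P] {C : Config P} (hN : Fintype.card P = 3 * C.f + 1)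
    (hbyz : C.byz.card ≤ C.f) {t : List (Action P V)} {s : State P V}
    (h : (lts V C).Run t s) : ∃ T, (QTree.lts V).Run (linearize C t) T ∧
      QTree.IsView {n | Announced C s .precommit n} {n | Announced C s .decide n} T := by
  induction h with
  | nil =>
    refine ⟨_, .nil, ?_⟩
    simpa [Announced, lts, State.init, QTree.lts] using QTree.isView_init V
  | @snoc t s s' a hrun hstep ih =>
    obtain ⟨T, hT, hview⟩ := ih
    have hs := run_inv hbyz hrun
    have hs' := hs.step hbyz hstep
    have hco := hs.coherent hN hbyz
    have hco' := hs'.coherent hN hbyz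
    have hsub : s.sent ⊆ s'.sent := fun m hm => (Step.sent_iff hstep m).2 (.inl hm)
    have hiff := announced_step_iff hstep
    rw [linearize_append]
    -- An action that announces nothing new is no linearization point.
    have hstay : linPoint C t a = none → (∀ m : LeadMsg P V, a = .send (.lead m) → m.Valid C →
        m.kind ≠ .commit → Announced C s m.kind m.node) →
        ∃ T, (QTree.lts V).Run (linearize C t ++ (linPoint C t a).toList) T ∧
        QTree.IsView {n | Announced C s' .precommit n} {n | Announced C s' .decide n} T := by
      intro hlin hold
      have : ∀ k, k ≠ .commit → {n | Announced C s' k n} = {n | Announced C s k n} := by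
        intro k hk
        ext n
        simp only [Set.mem_ofPred_eq, hiff]
        refine or_iff_left_of_imp ?_
        rintro ⟨m, ha, rfl, hv, rfl⟩
        exact hold m ha hv hk
      rw [this _ (by simp), this _ (by simp), hlin]
      exact ⟨T, by simpa using hT, hview⟩
    by_cases hlead : ∃ m : LeadMsg P V, a = .send (.lead m) ∧ m.Valid C ∧ m.kind ≠ .commit
    swap
    · refine hstay ?_ fun m ha hv hk => absurd ⟨m, ha, hv, hk⟩ hlead
      rcases a with (m | m | m | ⟨q, k, r, n, c⟩) | ⟨q, n⟩
      all_goals try rfl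
      have hnot : k ≠ .commit → ¬ FirstValid C t k r (.send (.lead ⟨q, k, r, n, c⟩)) := by
        rintro hk ⟨⟨_, ⟨⟩, -, -, hv⟩, -⟩
        exact hlead ⟨_, rfl, hv, hk⟩
      cases k
      · cases n
        · rfl
        · simp only [linPoint, if_neg (hnot (by simp))]
      · rfl
      · simp only [linPoint, if_neg (hnot (by simp))]
    obtain ⟨⟨q, k, r, n, c⟩, rfl, hv, hk⟩ := hlead
    simp only at hk
    have hann : Announced C s' k n := (hiff k n).2 (.inr ⟨_, rfl, rfl, hv, rfl⟩)
    have hnr : n.round = r :=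
      (hs'.node_round hbyz ((Step.sent_iff hstep _).2 (.inr rfl)) hv).1
    have hset : {x | Announced C s' k x} = insert n {x | Announced C s k x} := by
      ext x
      simp [hiff, hv, or_comm, eq_comm]
    have hset_ne : ∀ k', k' ≠ k → {x | Announced C s' k' x} = {x | Announced C s k' x} := by
      intro k' hkk
      ext x
      simp [hiff, hkk.symm]
    -- Being first for the round and being first for the node agree, because all valid messages of a
    -- round have the same node.
    have hfirst : FirstValid C t k r (.send (.lead ⟨q, k, r, n, c⟩)) ↔ ¬ Announced C s k n := by
      have h₁ : SendsValid C k r (.send (.lead ⟨q, k, r, n, c⟩)) := ⟨_, rfl, rfl, rfl, hv⟩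
      have h₂ := exists_sendsValid_iff hrun k r
      simp only [FirstValid, h₁, true_and]
      rw [← not_iff_not, not_not]
      push Not
      rw [h₂]
      constructor
      · rintro ⟨m, hm, rfl, hmr, hmv⟩
        refine ⟨m, hm, rfl, hmv, ?_⟩
        -- Uniqueness is applied in the state after the step, where both nodes are precommitted,
        -- whichever kind `k` is.
        refine hs'.announced_unique hbyz hN (hs'.announced_precommit hbyz ⟨m, hsub hm, rfl, hmv, rfl⟩)
          (hs'.announced_precommit hbyz hann) ?_
        rw [hnr, ← hmr]
        exact (hs.node_round hbyz hm hmv).1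
      · rintro ⟨m, hm, hmk, hmv, rfl⟩
        exact ⟨m, hm, hmk, (hs.node_round hbyz hm hmv).1.symm.trans hnr, hmv⟩
    by_cases hold : Announced C s k n
    · refine hstay ?_ ?_
      · cases k
        · cases n
          · rfl
          · simp only [linPoint, if_neg (fun h => hfirst.1 h hold)]
        · rfl
        · simp only [linPoint, if_neg (fun h => hfirst.1 h hold)]
      · rintro _ ⟨⟩ - -
        exact hold
    have hfirst' := hfirst.2 hold
    cases k with
    | commit => exact absurd rfl hk
    | precommit =>
      cases n with
      | genesis => exact absurd (hs'.round_pos hbyz hann) (lt_irrefl _)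
      | block r₀ v p =>
        obtain rfl : r₀ = r := hnr
        rw [hset, hset_ne _ (by simp)] at hco' ⊢
        obtain ⟨hstepT, hview'⟩ := hview.add hco hco' fun m hm hmr => hold <| by
          rw [← hs'.announced_unique hbyz hN (hm.mono hsub) hann hmr]
          exact hm
        refine ⟨_, ?_, hview'⟩
        simp only [linPoint, if_pos hfirst', Option.toList_some]
        exact hT.snoc hstepT
    | decide =>
      rw [hset, hset_ne _ (by simp)] at hco' ⊢
      obtain ⟨hstepT, hview'⟩ := hview.commit hco' hold
      refine ⟨_, ?_, hview'⟩
      simp only [linPoint, if_pos hfirst', Option.toList_some]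
      rw [← hnr]
      exact hT.snoc hstepT

end HotStuff

theorem mainTheorem5 {P V : Type*} [Fintype P] (C : HotStuff.Config P)
    (hN : Fintype.card P = 3 * C.f + 1) (hbyz : C.byz.card ≤ C.f) :
    LTS.Refines (HotStuff.linearize C) (HotStuff.lts V C) (QTree.lts V) := by
  rintro _ ⟨t, ⟨s, hs⟩, rfl⟩
  obtain ⟨T, hT, -⟩ := HotStuff.exists_view hN hbyz hs
  exact ⟨T, hT⟩
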